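/- Fix integers $r\ge 2$ and $K\ge 1$. For each $n$, let $H_n=(V(H_n),E(H_n))$ be a finite $r$-uniform hypergraph whose hyperedges $e$ carry integer weights $w_e\in[1,K]$, and let each vertex $v\in V(H_n)$ receive a random color $X_v\in\{1,\dots,c_n\}$, the colors being independent and each uniform on $\{1,\dots,c_n\}$, where $(c_n)$ is a sequence of positive integers with $c_n\to\infty$. For a hypergraph $H$ with vertex set $V(H_n)$ let $$T(H)=\sum_{e\in E(H)}\mathbf 1\{X_u=X_v\text{ for all }u,v\in e\}$$ be its number of monochromatic hyperedges, and put $$W(H_n)=\sum_{e\in E(H_n)}w_e\,\mathbf 1\{X_u=X_v\text{ for all }u,v\in e\}.$$ For $1\le i\le K$ let $H_n^{(i)}$ be the hypergraph with vertex set $V(H_n)$ and hyperedge set $\{e\in E(H_n): w_e=i\}$. Suppose that there are constants $\lambda_1,\dots,\lambda_K\ge 0$ such that, for each $1\le i\le K$, $$\lim_{n\to\infty}\mathbb E\,T(H_n^{(i)})=\lambda_i\quad\text{and}\quad\lim_{n\to\infty}\operatorname{Var}T(H_n^{(i)})=\lambda_i.$$ Then, as $n\to\infty$, $$W(H_n)\;\to\;\sum_{i=1}^K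 i\,Z_i\quad\text{in distribution},$$ where $Z_1,\dots,Z_K$ are independent and $Z_i\sim\mathrm{Pois}(\lambda_i)$. -/

import Mathlib

open MeasureTheory ProbabilityTheory Filter Topology
open scoped NNReal

namespace Hypergraph

/-- Every hyperedge of `H` has exactly `r` vertices. -/
def IsUniformOfSize {α : Type*} (H : Hypergraph α) (r : ℕ) : Prop :=
  ∀ e ∈ H.edgeSet, e.ncard = r

/-- The `i`-th weight layer of `H` for the edge weights `w`: the vertex set is that of `H`, and the
hyperedges are the hyperedges of `H` of weight `i`. -/
abbrev weightLayer {α : Type*} (H : Hypergraph α) (w : Set α → ℕ) (i : ℕ) : Hypergraph α where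
  vertexSet := H.vertexSet
  edgeSet := {e | e ∈ H.edgeSet ∧ w e = i}
  subset_vertexSet_of_mem_edgeSet' := fun _ he => H.subset_vertexSet_of_mem_edgeSet' he.1

/-- The set `e` is monochromatic for the colouring `x` of the vertex set `V`: all its vertices have
the same colour. -/
def IsMonochromatic {α C : Type*} {V : Set α} (x : V → C) (e : Set α) : Prop :=
  ∀ u v : V, (u : α) ∈ e → (v : α) ∈ e → x u = x v

open Classical in
/-- `T(H)`: the number of monochromatic hyperedges of `H` in the colouring `x` of its vertices,
as a sum of indicators (a finite sum when `H` has finitely many hyperedges). -/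
noncomputable def monoCount {α C : Type*} (H : Hypergraph α) (x : H.vertexSet → C) : ℕ :=
  ∑ᶠ e ∈ H.edgeSet, if IsMonochromatic x e then 1 else 0

open Classical in
/-- `W(H)`: the weighted number of monochromatic hyperedges of `H`, for the edge weights `w`,
in the colouring `x` of its vertices (a finite sum when `H` has finitely many hyperedges). -/
noncomputable def weightedMonoCount {α C : Type*} (H : Hypergraph α) (w : Set α → ℕ)
    (x : H.vertexSet → C) : ℕ :=
  ∑ᶠ e ∈ H.edgeSet, w e * if IsMonochromatic x e then 1 else 0

end Hypergraph

/-- `X` is a uniformly random colouring of `V` with `c` colours, on the probability space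
`(Ω, P)`: the colours `X v` of the elements `v` of `V` are independent random variables, and each
of them takes each of the `c` colours with probability `1 / c`. -/
structure IsUniformColoring {V Ω : Type*} [MeasurableSpace Ω] {c : ℕ} (X : V → Ω → Fin c)
    (P : Measure Ω) : Prop where
  measurable : ∀ v, Measurable (X v)
  indep : iIndepFun X P
  prob_eq : ∀ (v : V) (a : Fin c), P.real {ω | X v ω = a} = 1 / (c : ℝ)

/-! ### Recolouring a hyperedge, and first and second moments of the monochromatic indicators. -/

section Coloring

open Finset
open scoped BigOperators

variable {V : Type*} {c : ℕ}

/-- All vertices of the finite set `e` have the same colour. -/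
def IsMono (x : V → Fin c) (e : Finset V) : Prop := ∀ u ∈ e, ∀ v ∈ e, x u = x v

instance (x : V → Fin c) (e : Finset V) : Decidable (IsMono x e) := by
  unfold IsMono; infer_instance

/-- The indicator that `e` is monochromatic. -/
def monoInd (x : V → Fin c) (e : Finset V) : ℝ := if IsMono x e then 1 else 0

lemma monoInd_nonneg (x : V → Fin c) (e : Finset V) : 0 ≤ monoInd x e := by
  unfold monoInd; split_ifs <;> norm_num

variable [DecidableEq V]

/-- Give all vertices of `e` the colour of `u`. -/
def recolor (e : Finset V) (u : V) (x : V → Fin c) : V → Fin c :=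
  fun v => if v ∈ e then x u else x v

lemma monoInd_recolor_of_inter_subset {e f : Finset V} {u : V} (h : f ∩ e ⊆ {u})
    (x : V → Fin c) : monoInd (recolor e u x) f = monoInd x f := by
  have key : ∀ v ∈ f, recolor e u x v = x v := by
    intro v hv
    unfold recolor
    split_ifs with hve
    · rw [Finset.mem_singleton.1 (h (Finset.mem_inter.2 ⟨hv, hve⟩))]
    · rfl
  unfold monoInd IsMono
  congr 1
  apply propext
  constructor <;> intro H a ha b hb
  · rw [← key a ha, ← key b hb]; exact H a ha b hb
  · rw [key a ha, key b hb]; exact H a ha b hb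

/-- After recolouring, all of `f ∩ e` carries the colour of `u`, so these vertices merge into the
single vertex `u`. -/
lemma monoInd_recolor_of_inter_nonempty {e f : Finset V} {u : V} (hu : u ∈ e)
    (h : (f ∩ e).Nonempty) (x : V → Fin c) :
    monoInd (recolor e u x) f = monoInd x (insert u (f \ e)) := by
  obtain ⟨z, hz⟩ := h
  rw [Finset.mem_inter] at hz
  unfold monoInd
  congr 1
  apply propext
  unfold IsMono recolor
  constructor
  · intro H
    have hz' : ∀ a ∈ f \ e, x a = x u := by
      intro a ha
      rw [Finset.mem_sdiff] at ha
      have := H a ha.1 z hz.1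
      simpa [ha.2, hz.2] using this
    intro a ha b hb
    rw [Finset.mem_insert] at ha hb
    rcases ha with rfl | ha <;> rcases hb with rfl | hb
    · rfl
    · exact (hz' b hb).symm
    · exact hz' a ha
    · rw [hz' a ha, hz' b hb]
  · intro H
    have hz' : ∀ a ∈ f, a ∉ e → x a = x u := fun a ha hae =>
      H a (by simp [ha, hae]) u (by simp)
    intro a ha b hb
    split_ifs with h1 h2 h2
    · rfl
    · exact (hz' b hb h2).symm
    · exact hz' a ha h1
    · rw [hz' a ha h1, hz' b hb h2]

lemma isMono_recolor (e : Finset V) (u : V) (x : V → Fin c) : IsMono (recolor e u x) e := by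
  intro a ha b hb
  simp [recolor, ha, hb]

variable [Fintype V]

/-- A preimage of `y` is free on `e \ {u}` and pinned to `y` elsewhere. -/
lemma card_filter_recolor_eq {e : Finset V} {u : V} (hu : u ∈ e) {y : V → Fin c}
    (hy : IsMono y e) :
    #{x : V → Fin c | recolor e u x = y} = c ^ (#e - 1) := by
  have : ({x : V → Fin c | recolor e u x = y} : Finset (V → Fin c)) =
      Fintype.piFinset (fun v => if v ∈ e.erase u then Finset.univ else {y v}) := by
    ext x
    simp only [Finset.mem_filter, Finset.mem_univ, true_and, Fintype.mem_piFinset]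
    constructor
    · rintro rfl v
      by_cases hv : v ∈ e.erase u
      · simp [hv]
      · rw [if_neg hv, Finset.mem_singleton]
        unfold recolor
        by_cases hve : v ∈ e
        · have : v = u := by by_contra hne; exact hv (Finset.mem_erase.2 ⟨hne, hve⟩)
          simp [this]
        · simp [hve]
    · intro H
      have hxu : x u = y u := by simpa using H u
      ext v
      unfold recolor
      split_ifs with hve
      · rw [hxu, hy u hu v hve]
      · have := H v
        simp [hve] at this
        rw [this]
  rw [this, Fintype.card_piFinset]
  have : ∀ v, #(if v ∈ e.erase u then (Finset.univ : Finset (Fin c)) else {y v}) =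
      if v ∈ e.erase u then c else 1 := by
    intro v; split_ifs <;> simp
  simp_rw [this]
  rw [Finset.prod_ite_mem, Finset.univ_inter, Finset.prod_const, Finset.card_erase_of_mem hu]

/-- All nonempty fibres of `recolor e u` have the same size, so it pushes the uniform law to the
uniform law conditioned on `e` being monochromatic. -/
lemma expect_ite_isMono {𝕜 : Type*} [Field 𝕜] [CharZero 𝕜] [NeZero c] {e : Finset V} {u : V}
    (hu : u ∈ e) (g : (V → Fin c) → 𝕜) :
    𝔼 x, (if IsMono x e then g x else 0) =
      ((c : 𝕜) ^ (#e - 1))⁻¹ * 𝔼 x, g (recolor e u x) := by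
  have hc : (c : 𝕜) ≠ 0 := by exact_mod_cast NeZero.ne c
  have key : ∑ x, g (recolor e u x) =
      (c : 𝕜) ^ (#e - 1) * ∑ x : V → Fin c, (if IsMono x e then g x else 0) := by
    rw [← Finset.sum_fiberwise' (s := Finset.univ) (fun x : V → Fin c => recolor e u x) g,
      Finset.mul_sum]
    refine Finset.sum_congr rfl fun y _ => ?_
    rw [Finset.sum_const]
    split_ifs with hy
    · rw [card_filter_recolor_eq hu hy]; simp
    · rw [Finset.filter_false_of_mem, Finset.card_empty]
      · simp
      · rintro x - rfl
        exact hy (isMono_recolor e u x)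
  simp only [Finset.expect_eq_sum_div_card, key]
  field_simp

lemma expect_monoInd_mul [NeZero c] {e : Finset V} {u : V}
    (hu : u ∈ e) (g : (V → Fin c) → ℝ) :
    𝔼 x, monoInd x e * g x = ((c : ℝ) ^ (#e - 1))⁻¹ * 𝔼 x, g (recolor e u x) := by
  rw [← expect_ite_isMono hu]
  refine Finset.expect_congr rfl fun x _ => ?_
  unfold monoInd; split_ifs <;> simp

lemma expect_monoInd [NeZero c] {e : Finset V} (he : e.Nonempty) :
    𝔼 x : V → Fin c, monoInd x e = ((c : ℝ) ^ (#e - 1))⁻¹ := by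
  obtain ⟨u, hu⟩ := he
  have := expect_monoInd_mul (c := c) hu (fun _ => (1 : ℝ))
  simpa using this

variable {r : ℕ}

lemma expect_monoInd_recolor [NeZero c] {e f : Finset V} {u : V} (hu : u ∈ e) (hf : #f = r)
    (h : (f ∩ e).Nonempty) :
    𝔼 x : V → Fin c, monoInd (recolor e u x) f = (c : ℝ) ^ #(f ∩ e) / (c : ℝ) ^ r := by
  have hc : (c : ℝ) ≠ 0 := by exact_mod_cast NeZero.ne c
  simp_rw [monoInd_recolor_of_inter_nonempty hu h]
  rw [expect_monoInd (Finset.insert_nonempty _ _), Finset.card_insert_of_notMem (by simp [hu])]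
  have := Finset.card_sdiff_add_card_inter f e
  rw [Nat.add_sub_cancel, ← hf, ← this, pow_add]
  field_simp

/-- The union has `2r - #(f ∩ e)` vertices, all forced to one colour. With one shared vertex this is
the product of the two probabilities. -/
lemma expect_monoInd_mul_monoInd [NeZero c] (hr : 1 ≤ r) {e f : Finset V} (he : #e = r)
    (hf : #f = r) (h : (f ∩ e).Nonempty) :
    𝔼 x : V → Fin c, monoInd x e * monoInd x f =
      (c : ℝ) ^ #(f ∩ e) / (c : ℝ) ^ (2 * r - 1) := by
  obtain ⟨u, hu⟩ : e.Nonempty := h.mono Finset.inter_subset_right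
  rw [expect_monoInd_mul hu, expect_monoInd_recolor hu hf h, he,
    show 2 * r - 1 = (r - 1) + r by omega, pow_add]
  field_simp

lemma expect_monoInd_mul_monoInd_of_inter_eq_empty [NeZero c] (hr : 1 ≤ r) {e f : Finset V}
    (he : #e = r) (hf : #f = r) (h : f ∩ e = ∅) :
    𝔼 x : V → Fin c, monoInd x e * monoInd x f = ((c : ℝ) ^ (r - 1))⁻¹ ^ 2 := by
  obtain ⟨u, hu⟩ : e.Nonempty := Finset.card_pos.1 (by omega)
  rw [expect_monoInd_mul hu]
  simp_rw [monoInd_recolor_of_inter_subset (u := u) (h.trans_subset (Finset.empty_subset _))]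
  rw [expect_monoInd (Finset.card_pos.1 (by omega)), he, hf, sq]

end Coloring

/-! ### Combinatorics of overlapping hyperedges. -/

section Overlap

open Finset
open scoped BigOperators

variable {V : Type*} [DecidableEq V]

/-- The pairs of distinct hyperedges of `E` that share at least two vertices, each counted with
weight `c` to the number of shared vertices. -/
def overlap (c : ℕ) (E : Finset (Finset V)) : ℝ :=
  ∑ e ∈ E, ∑ f ∈ E with f ≠ e ∧ 2 ≤ #(f ∩ e), (c : ℝ) ^ #(f ∩ e)

lemma overlap_nonneg (c : ℕ) (E : Finset (Finset V)) : 0 ≤ overlap c E :=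
  Finset.sum_nonneg fun _ _ => Finset.sum_nonneg fun _ _ => by positivity

lemma card_inter_lt {r : ℕ} {e f : Finset V} (he : #e = r) (hf : #f = r) (hne : f ≠ e) :
    #(f ∩ e) < r := by
  by_contra! h
  have h1 : f ∩ e = f := Finset.eq_of_subset_of_card_le Finset.inter_subset_left (by omega)
  have h2 : f ∩ e = e := Finset.eq_of_subset_of_card_le Finset.inter_subset_right (by omega)
  exact hne (h1.symm.trans h2)

variable {c r : ℕ}

/-- Double counting: the squared count is the number of ordered pairs `(e, f)` with `S ⊆ f ∩ e`. -/
lemma sum_pow_mul_sq_card_filter_subset (𝒮 E : Finset (Finset V)) :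
    ∑ S ∈ 𝒮, (c : ℝ) ^ #S * (#{e ∈ E | S ⊆ e} : ℝ) ^ 2 =
      ∑ e ∈ E, ∑ f ∈ E, ∑ S ∈ 𝒮 with S ⊆ f ∩ e, (c : ℝ) ^ #S := by
  have h1 : ∀ S : Finset V, (c : ℝ) ^ #S * (#{e ∈ E | S ⊆ e} : ℝ) ^ 2 =
      ∑ e ∈ E, ∑ f ∈ E, if S ⊆ f ∩ e then (c : ℝ) ^ #S else 0 := by
    intro S
    rw [sq, Finset.card_filter]
    push_cast
    rw [Finset.sum_mul_sum, Finset.mul_sum]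
    refine Finset.sum_congr rfl fun e _ => ?_
    rw [Finset.mul_sum]
    refine Finset.sum_congr rfl fun f _ => ?_
    simp only [Finset.subset_inter_iff]
    by_cases h1 : S ⊆ e <;> by_cases h2 : S ⊆ f <;> simp [h1, h2]
  simp_rw [h1]
  rw [Finset.sum_comm]
  refine Finset.sum_congr rfl fun e _ => ?_
  rw [Finset.sum_comm]
  refine Finset.sum_congr rfl fun f _ => ?_
  rw [Finset.sum_filter]

lemma sum_filter_subset_pow_le (hc : 1 ≤ c) {T : Finset V} {k : ℕ} (hT : #T ≤ r)
    (𝒮 : Finset (Finset V)) (hk : ∀ S ∈ 𝒮, S ⊆ T → #S ≤ k) :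
    ∑ S ∈ 𝒮 with S ⊆ T, (c : ℝ) ^ #S ≤ 2 ^ r * (c : ℝ) ^ k := by
  have hc' : (1 : ℝ) ≤ c := by exact_mod_cast hc
  calc ∑ S ∈ 𝒮 with S ⊆ T, (c : ℝ) ^ #S
      ≤ #{S ∈ 𝒮 | S ⊆ T} • (c : ℝ) ^ k := by
        refine Finset.sum_le_card_nsmul _ _ _ fun S hS => ?_
        rw [Finset.mem_filter] at hS
        exact pow_le_pow_right₀ hc' (hk S hS.1 hS.2)
    _ ≤ 2 ^ r * (c : ℝ) ^ k := by
        rw [nsmul_eq_mul]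
        refine mul_le_mul_of_nonneg_right ?_ (by positivity)
        have : #{S ∈ 𝒮 | S ⊆ T} ≤ 2 ^ r := by
          calc #{S ∈ 𝒮 | S ⊆ T} ≤ #T.powerset := Finset.card_le_card fun S hS => by
                rw [Finset.mem_filter] at hS; exact Finset.mem_powerset.2 hS.2
            _ = 2 ^ #T := Finset.card_powerset T
            _ ≤ 2 ^ r := Nat.pow_le_pow_right (by norm_num) hT
        exact_mod_cast this

variable [Fintype V]

/-- For each overlapping pair, keep only the term `S = f ∩ e`. -/
lemma overlap_le_sum_pow_mul_sq {E : Finset (Finset V)} (hE : ∀ e ∈ E, #e = r) :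
    overlap c E ≤ ∑ S : Finset V with 2 ≤ #S ∧ #S < r,
      (c : ℝ) ^ #S * (#{e ∈ E | S ⊆ e} : ℝ) ^ 2 := by
  rw [sum_pow_mul_sq_card_filter_subset]
  refine Finset.sum_le_sum fun e he => ?_
  rw [Finset.sum_filter]
  refine Finset.sum_le_sum fun f hf => ?_
  split_ifs with h
  · refine Finset.single_le_sum (f := fun S : Finset V => (c : ℝ) ^ #S)
      (fun _ _ => by positivity) ?_
    have := card_inter_lt (hE e he) (hE f hf) h.1
    simp [h.2, this]
  · exact Finset.sum_nonneg fun _ _ => by positivity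

/-- Converse to `overlap_le_sum_pow_mul_sq`: each pair has at most `2 ^ r` common subsets. The
restriction `#S < r` keeps the diagonal at `c ^ (r - 1)`, which is negligible after division by `c ^
(2 * r - 1)`. -/
lemma sum_pow_mul_sq_le_overlap (hc : 1 ≤ c) {E : Finset (Finset V)}
    (hE : ∀ e ∈ E, #e = r) :
    ∑ S : Finset V with 2 ≤ #S ∧ #S < r, (c : ℝ) ^ #S * (#{e ∈ E | S ⊆ e} : ℝ) ^ 2 ≤
      2 ^ r * (#E * (c : ℝ) ^ (r - 1) + overlap c E) := by
  rw [sum_pow_mul_sq_card_filter_subset, overlap, mul_add, Finset.mul_sum, ← nsmul_eq_mul,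
    ← Finset.sum_const, Finset.mul_sum, ← Finset.sum_add_distrib]
  refine Finset.sum_le_sum fun e he => ?_
  rw [← Finset.add_sum_erase _ _ he]
  refine add_le_add ?_ ?_
  · refine sum_filter_subset_pow_le hc ?_ _ fun S hS _ => ?_
    · simp [hE e he]
    · simp only [Finset.mem_filter] at hS
      omega
  · rw [Finset.mul_sum, Finset.sum_filter, ← Finset.add_sum_erase _ _ he, if_neg (by simp),
      zero_add]
    refine Finset.sum_le_sum fun f hf => ?_
    rw [Finset.mem_erase] at hf
    have hlt := card_inter_lt (hE e he) (hE f hf.2) hf.1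
    split_ifs with h
    · exact sum_filter_subset_pow_le hc hlt.le _ fun S _ hS => Finset.card_le_card hS
    · refine le_of_eq (Finset.sum_eq_zero fun S hS => ?_)
      simp only [Finset.mem_filter, Finset.mem_univ, true_and] at hS
      exact absurd ⟨hf.1, hS.1.1.trans (Finset.card_le_card hS.2)⟩ h

/-- The number of hyperedges containing `S` is additive over the layers, so Cauchy–Schwarz on its
square removes the cross terms between layers. -/
lemma overlap_le_sum_layers (hc : 1 ≤ c) {E : Finset (Finset V)} (hE : ∀ e ∈ E, #e = r)
    {w : Finset V → ℕ} {s : Finset ℕ} (hw : ∀ e ∈ E, w e ∈ s) :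
    overlap c E ≤ #s * ∑ i ∈ s, 2 ^ r *
      (#{e ∈ E | w e = i} * (c : ℝ) ^ (r - 1) + overlap c {e ∈ E | w e = i}) := by
  refine (overlap_le_sum_pow_mul_sq hE).trans ?_
  have h1 : ∀ S : Finset V, (#{e ∈ E | S ⊆ e} : ℝ) ^ 2 ≤
      #s * ∑ i ∈ s, (#{e ∈ {e ∈ E | w e = i} | S ⊆ e} : ℝ) ^ 2 := by
    intro S
    have : #{e ∈ E | S ⊆ e} = ∑ i ∈ s, #{e ∈ {e ∈ E | w e = i} | S ⊆ e} := by
      rw [Finset.card_eq_sum_card_fiberwise (f := w) (t := s)]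
      · simp_rw [Finset.filter_comm]
      · intro e he
        simp only [Finset.coe_filter, Set.mem_ofPred_eq] at he
        exact hw e he.1
    rw [this]
    push_cast
    exact sq_sum_le_card_mul_sum_sq
  calc _ ≤ ∑ S : Finset V with 2 ≤ #S ∧ #S < r, (c : ℝ) ^ #S *
          (#s * ∑ i ∈ s, (#{e ∈ {e ∈ E | w e = i} | S ⊆ e} : ℝ) ^ 2) :=
        Finset.sum_le_sum fun S _ => mul_le_mul_of_nonneg_left (h1 S) (by positivity)
    _ = #s * ∑ i ∈ s, ∑ S : Finset V with 2 ≤ #S ∧ #S < r, (c : ℝ) ^ #S *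
          (#{e ∈ {e ∈ E | w e = i} | S ⊆ e} : ℝ) ^ 2 := by
        rw [Finset.sum_comm, Finset.mul_sum]
        refine Finset.sum_congr rfl fun S _ => ?_
        rw [← Finset.mul_sum]; ring
    _ ≤ _ := by
        refine mul_le_mul_of_nonneg_left (Finset.sum_le_sum fun i _ => ?_) (by positivity)
        exact sum_pow_mul_sq_le_overlap hc fun e he => hE e (Finset.mem_filter.1 he).1

/-- In a uniform hypergraph a vertex of each hyperedge can be chosen so that few pairs of
hyperedges meet exactly in a vertex not chosen for the first one. -/
lemma exists_vertex_choice [Nonempty V] {E : Finset (Finset V)} (hr : 1 ≤ r) (hE : ∀ e ∈ E, #e = r) :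
    ∃ u : Finset V → V, (∀ e ∈ E, u e ∈ e) ∧
      ((∑ e ∈ E, #{f ∈ E | #(f ∩ e) = 1 ∧ ¬ f ∩ e ⊆ {u e}} : ℕ) : ℝ) ^ 2 ≤
        (∑ e ∈ E, ∑ f ∈ E, if 2 ≤ #(f ∩ e) then (r : ℝ) ^ 2 else 0) * (r * #E : ℝ) ^ 2 := by
  set d : V → ℕ := fun v => #{f ∈ E | v ∈ f} with hd
  have hne : ∀ e ∈ E, e.Nonempty := fun e he => Finset.card_pos.1 (by rw [hE e he]; omega)
  have hex : ∀ e : Finset V, ∃ v, e ∈ E → v ∈ e ∧ ∀ a ∈ e, d a ≤ d v := by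
    intro e
    by_cases he : e ∈ E
    · obtain ⟨v, hv, h⟩ := Finset.exists_max_image e d (hne e he)
      exact ⟨v, fun _ => ⟨hv, h⟩⟩
    -- Outside `E` the choice is an irrelevant default.
    · exact ⟨Classical.arbitrary V, fun h => absurd h he⟩
  choose u hu using hex
  refine ⟨u, fun e he => (hu e he).1, ?_⟩
  set codeg : V × V → ℕ := fun p => #{e ∈ E | p.1 ∈ e ∧ p.2 ∈ e} with hcodeg
  set D : Finset (V × V) := Finset.univ.filter fun p => p.1 ≠ p.2 with hD
  have hdsum : ∑ v, d v = r * #E := by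
    simp only [hd, Finset.card_filter]
    rw [Finset.sum_comm, Finset.sum_congr rfl (g := fun _ => r), Finset.sum_const, smul_eq_mul,
      mul_comm]
    intro e he
    simp [hE e he]
  -- A bad `f` passes through some `v ≠ u e` of `e`. There are at most `d v = min (d v) (d (u e))`
  -- of these, by maximality of `d (u e)` on `e`.
  have h1 : (∑ e ∈ E, #{f ∈ E | #(f ∩ e) = 1 ∧ ¬ f ∩ e ⊆ {u e}}) ≤
      ∑ p ∈ D, codeg p * min (d p.1) (d p.2) := by
    calc _ ≤ ∑ e ∈ E, ∑ p ∈ D, if p.1 ∈ e ∧ p.2 ∈ e then min (d p.1) (d p.2) else 0 := by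
          refine Finset.sum_le_sum fun e he => ?_
          calc #{f ∈ E | #(f ∩ e) = 1 ∧ ¬ f ∩ e ⊆ {u e}}
              ≤ ∑ v ∈ e.erase (u e), d v := by
                refine le_trans (Finset.card_le_card (t := (e.erase (u e)).biUnion
                  fun v => {f ∈ E | v ∈ f}) ?_) Finset.card_biUnion_le
                intro f hf
                rw [Finset.mem_filter] at hf
                obtain ⟨v, hv, hvu⟩ := Finset.not_subset.1 hf.2.2
                rw [Finset.mem_inter] at hv
                rw [Finset.mem_singleton] at hvu
                simp only [Finset.mem_biUnion, Finset.mem_erase, Finset.mem_filter]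
                exact ⟨v, ⟨hvu, hv.2⟩, hf.1, hv.1⟩
            _ = ∑ p ∈ (e.erase (u e)).image (fun v => (v, u e)), min (d p.1) (d p.2) := by
                rw [Finset.sum_image (by intro a _ b _ h; exact (Prod.mk.inj h).1)]
                refine Finset.sum_congr rfl fun v hv => ?_
                exact (min_eq_left ((hu e he).2 v (Finset.mem_of_mem_erase hv))).symm
            _ ≤ ∑ p ∈ D with p.1 ∈ e ∧ p.2 ∈ e, min (d p.1) (d p.2) := by
                refine Finset.sum_le_sum_of_subset fun p hp => ?_
                obtain ⟨v, hv, rfl⟩ := Finset.mem_image.1 hp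
                rw [Finset.mem_erase] at hv
                simp [hD, hv.1, hv.2, (hu e he).1]
            _ = _ := by rw [Finset.sum_filter]
      _ = _ := by
          rw [Finset.sum_comm]
          refine Finset.sum_congr rfl fun p _ => ?_
          rw [← Finset.sum_filter, Finset.sum_const, smul_eq_mul]
  have h2 : (∑ p ∈ D, codeg p * min (d p.1) (d p.2)) ^ 2 ≤
      (∑ p ∈ D, codeg p ^ 2) * ∑ p ∈ D, min (d p.1) (d p.2) ^ 2 :=
    Finset.sum_mul_sq_le_sq_mul_sq _ _ _
  -- The minimum pays off here: its square is at most the product of the degrees, whose sum factors.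
  have h3 : ∑ p ∈ D, min (d p.1) (d p.2) ^ 2 ≤ (r * #E) ^ 2 := by
    calc _ ≤ ∑ p : V × V, d p.1 * d p.2 := by
          refine (Finset.sum_le_sum_of_subset (Finset.subset_univ _)).trans
            (Finset.sum_le_sum fun p _ => ?_)
          rw [sq]
          exact Nat.mul_le_mul (min_le_left _ _) (min_le_right _ _)
      _ = _ := by
          rw [← Finset.univ_product_univ, Finset.sum_product, ← Finset.sum_mul_sum, hdsum, sq]
  -- Two distinct vertices common to `e` and `f` force `2 ≤ #(f ∩ e)`, and there are at most `r ^ 2`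
  -- such vertex pairs.
  have h4 : ∑ p ∈ D, codeg p ^ 2 ≤ ∑ e ∈ E, ∑ f ∈ E, if 2 ≤ #(f ∩ e) then r ^ 2 else 0 := by
    have : ∀ p, codeg p ^ 2 = ∑ e ∈ E, ∑ f ∈ E,
        if p.1 ∈ f ∩ e ∧ p.2 ∈ f ∩ e then 1 else 0 := by
      intro p
      rw [sq, hcodeg]
      simp only [Finset.card_filter]
      rw [Finset.sum_mul_sum]
      refine Finset.sum_congr rfl fun e _ => Finset.sum_congr rfl fun f _ => ?_
      simp only [Finset.mem_inter]
      split_ifs <;> simp_all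
    simp_rw [this]
    rw [Finset.sum_comm]
    refine Finset.sum_le_sum fun e he => ?_
    rw [Finset.sum_comm]
    refine Finset.sum_le_sum fun f hf => ?_
    rw [← Finset.card_filter]
    have hsub : #{p ∈ D | p.1 ∈ f ∩ e ∧ p.2 ∈ f ∩ e} ≤ #(f ∩ e) ^ 2 := by
      rw [sq, ← Finset.card_product]
      refine Finset.card_le_card fun p hp => ?_
      rw [Finset.mem_filter] at hp
      exact Finset.mem_product.2 hp.2
    split_ifs with h
    · refine hsub.trans (Nat.pow_le_pow_left ?_ 2)
      exact (Finset.card_le_card Finset.inter_subset_right).trans (hE e he).le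
    · rw [Nat.le_zero, Finset.card_eq_zero, Finset.filter_eq_empty_iff]
      rintro p hp ⟨ha, hb⟩
      rw [hD, Finset.mem_filter] at hp
      exact h (Finset.one_lt_card.2 ⟨p.1, ha, p.2, hb, hp.2⟩)
  have h5 := (Nat.pow_le_pow_left h1 2).trans (h2.trans (Nat.mul_le_mul h4 h3))
  exact_mod_cast h5

omit [Fintype V] in
lemma sum_sum_ite_sq_le (hc : 1 ≤ c) (E : Finset (Finset V)) :
    (∑ e ∈ E, ∑ f ∈ E, if 2 ≤ #(f ∩ e) then (r : ℝ) ^ 2 else 0) ≤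
      (r : ℝ) ^ 2 * (#E + overlap c E / (c : ℝ) ^ 2) := by
  have hc' : (1 : ℝ) ≤ c := by exact_mod_cast hc
  have hc0 : (0 : ℝ) < c := by linarith
  rw [overlap, mul_add, Finset.sum_div, Finset.mul_sum, mul_comm _ (#E : ℝ), ← nsmul_eq_mul,
    ← Finset.sum_const, ← Finset.sum_add_distrib]
  refine Finset.sum_le_sum fun e he => ?_
  rw [← Finset.add_sum_erase _ _ he]
  refine add_le_add ?_ ?_
  · split_ifs
    · exact le_rfl
    · positivity
  · rw [Finset.sum_filter, ← Finset.add_sum_erase _ _ he, if_neg (by simp), zero_add,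
      Finset.sum_div, Finset.mul_sum]
    refine Finset.sum_le_sum fun f hf => ?_
    rw [Finset.mem_erase] at hf
    by_cases h : 2 ≤ #(f ∩ e)
    · rw [if_pos h, if_pos ⟨hf.1, h⟩]
      refine le_mul_of_one_le_right (by positivity) ?_
      rw [one_le_div (by positivity)]
      exact pow_le_pow_right₀ hc' h
    · simp [h]

end Overlap

/-! ### Overlaps bounded by the variance, and the effect of recolouring. -/

section Estimates

open Finset
open scoped BigOperators

variable {V : Type*} [DecidableEq V] [Fintype V] {c r : ℕ} [NeZero c]

lemma expect_sum_monoInd (hr : 1 ≤ r) {E : Finset (Finset V)} (hE : ∀ e ∈ E, #e = r) :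
    𝔼 x : V → Fin c, ∑ e ∈ E, monoInd x e = #E * ((c : ℝ) ^ (r - 1))⁻¹ := by
  rw [Finset.expect_sum_comm, ← nsmul_eq_mul, ← Finset.sum_const]
  refine Finset.sum_congr rfl fun e he => ?_
  rw [expect_monoInd (Finset.card_pos.1 (by rw [hE e he]; omega)), hE e he]

lemma le_expect_monoInd_mul_monoInd (hc : 2 ≤ c) (hr : 2 ≤ r) {e f : Finset V} (he : #e = r)
    (hf : #f = r) :
    ((c : ℝ) ^ (r - 1))⁻¹ ^ 2 +
      (if 2 ≤ #(f ∩ e) then (c : ℝ) ^ #(f ∩ e) / (c : ℝ) ^ (2 * r - 1) / 2 else 0) ≤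
    𝔼 x : V → Fin c, monoInd x e * monoInd x f := by
  have hc' : (2 : ℝ) ≤ c := by exact_mod_cast hc
  have hc0 : (0 : ℝ) < c := by linarith
  have hp : ((c : ℝ) ^ (r - 1))⁻¹ ^ 2 = c / (c : ℝ) ^ (2 * r - 1) := by
    rw [inv_pow, ← pow_mul, show 2 * r - 1 = (r - 1) * 2 + 1 by omega, pow_succ]
    field_simp
  rcases Finset.eq_empty_or_nonempty (f ∩ e) with h | h
  · rw [expect_monoInd_mul_monoInd_of_inter_eq_empty (by omega) he hf h]
    simp [h]
  · rw [expect_monoInd_mul_monoInd (by omega) he hf h, hp]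
    split_ifs with h2
    · rw [div_div, mul_comm _ (2 : ℝ), ← div_div, ← add_div]
      refine div_le_div_of_nonneg_right ?_ (by positivity)
      have h3 : (c : ℝ) ^ 2 ≤ (c : ℝ) ^ #(f ∩ e) := pow_le_pow_right₀ (by linarith) h2
      -- Since `2 ≤ c`, `c ≤ c ^ 2 / 2`, so at least half of the joint probability is excess over
      -- the independent value.
      nlinarith
    · rw [add_zero]
      refine div_le_div_of_nonneg_right ?_ (by positivity)
      exact le_self_pow₀ (by linarith) (Finset.card_pos.2 h).ne'

/-- The overlaps of a hypergraph are controlled by the difference of the variance and the mean of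
its number of monochromatic hyperedges. -/
lemma overlap_div_le (hc : 2 ≤ c) (hr : 2 ≤ r) {E : Finset (Finset V)}
    (hE : ∀ e ∈ E, #e = r) :
    overlap c E / (c : ℝ) ^ (2 * r - 1) ≤
      2 * ((𝔼 x : V → Fin c, (∑ e ∈ E, monoInd x e) ^ 2) -
        (#E * ((c : ℝ) ^ (r - 1))⁻¹) ^ 2 - #E * ((c : ℝ) ^ (r - 1))⁻¹ +
        #E * ((c : ℝ) ^ (r - 1))⁻¹ ^ 2) := by
  set p : ℝ := ((c : ℝ) ^ (r - 1))⁻¹ with hp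
  have hdiag : ∀ e ∈ E, 𝔼 x : V → Fin c, monoInd x e * monoInd x e = p := by
    intro e he
    have h : (e ∩ e).Nonempty := by
      rw [Finset.inter_self]; exact Finset.card_pos.1 (by rw [hE e he]; omega)
    have hc0 : (c : ℝ) ≠ 0 := by exact_mod_cast NeZero.ne c
    rw [expect_monoInd_mul_monoInd (by omega) (hE e he) (hE e he) h, Finset.inter_self, hE e he,
      show 2 * r - 1 = (r - 1) + r by omega, pow_add, hp]
    field_simp
  have hexp : 𝔼 x : V → Fin c, (∑ e ∈ E, monoInd x e) ^ 2 =
      ∑ e ∈ E, ∑ f ∈ E, 𝔼 x : V → Fin c, monoInd x e * monoInd x f := by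
    simp_rw [sq, Finset.sum_mul_sum]
    rw [Finset.expect_sum_comm]
    refine Finset.sum_congr rfl fun e _ => ?_
    rw [Finset.expect_sum_comm]
  have hsum : (#E : ℝ) * p + ((#E : ℝ) * #E - #E) * p ^ 2 +
      overlap c E / (c : ℝ) ^ (2 * r - 1) / 2 ≤
      𝔼 x : V → Fin c, (∑ e ∈ E, monoInd x e) ^ 2 := by
    rw [hexp]
    calc _ = ∑ e ∈ E, (p + ∑ f ∈ E.erase e, (p ^ 2 +
          if 2 ≤ #(f ∩ e) then (c : ℝ) ^ #(f ∩ e) / (c : ℝ) ^ (2 * r - 1) / 2 else 0)) := by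
          rw [Finset.sum_add_distrib, Finset.sum_const, nsmul_eq_mul, overlap, add_assoc,
            Finset.sum_div, Finset.sum_div]
          congr 1
          have h1 : ∀ e ∈ E, ∑ f ∈ E.erase e, p ^ 2 = ((#E : ℝ) - 1) * p ^ 2 := by
            intro e he
            rw [Finset.sum_const, nsmul_eq_mul, Finset.card_erase_of_mem he,
              Nat.cast_pred (Finset.card_pos.2 ⟨e, he⟩)]
          rw [Finset.sum_congr rfl fun e _ => Finset.sum_add_distrib, Finset.sum_add_distrib,
            Finset.sum_congr rfl h1, Finset.sum_const, nsmul_eq_mul]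
          congr 1
          · ring
          · refine Finset.sum_congr rfl fun e he => ?_
            rw [Finset.sum_filter, ← Finset.add_sum_erase _ _ he, if_neg (by simp), zero_add,
              Finset.sum_div, Finset.sum_div]
            refine Finset.sum_congr rfl fun f hf => ?_
            rw [Finset.mem_erase] at hf
            by_cases h : 2 ≤ #(f ∩ e) <;> simp [h, hf.1]
      _ ≤ _ := by
          refine Finset.sum_le_sum fun e he => ?_
          rw [← Finset.add_sum_erase _ _ he, hdiag e he]
          refine add_le_add le_rfl (Finset.sum_le_sum fun f hf => ?_)
          exact le_expect_monoInd_mul_monoInd hc hr (hE e he) (hE f (Finset.mem_of_mem_erase hf))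
  nlinarith

/-- Nothing changes if `f` meets `e` at most in `u`. Otherwise the difference is bounded by the sum
of the two indicators, and the recolored one has the larger mean. -/
lemma expect_abs_monoInd_recolor_sub_le (hr : 1 ≤ r) {e f : Finset V} {u : V} (hu : u ∈ e)
    (hf : #f = r) :
    𝔼 x : V → Fin c, |monoInd (recolor e u x) f - monoInd x f| ≤
      (if #(f ∩ e) = 1 ∧ ¬ f ∩ e ⊆ {u} then 2 * ((c : ℝ) ^ (r - 1))⁻¹ else 0) +
      (if 2 ≤ #(f ∩ e) then 2 * ((c : ℝ) ^ #(f ∩ e) / (c : ℝ) ^ r) else 0) := by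
  have hc1 : (1 : ℝ) ≤ c := by exact_mod_cast NeZero.one_le
  have hc0 : (0 : ℝ) < c := by linarith
  by_cases hsub : f ∩ e ⊆ {u}
  · simp_rw [monoInd_recolor_of_inter_subset hsub]
    simp only [sub_self, abs_zero, Finset.expect_const_zero]
    refine add_nonneg ?_ ?_ <;> split_ifs <;> positivity
  have hne : (f ∩ e).Nonempty := by
    by_contra h
    rw [Finset.not_nonempty_iff_eq_empty] at h
    simp [h] at hsub
  have hp : ((c : ℝ) ^ (r - 1))⁻¹ = (c : ℝ) ^ 1 / (c : ℝ) ^ r := by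
    obtain ⟨s, rfl⟩ : ∃ s, r = s + 1 := ⟨r - 1, by omega⟩
    rw [Nat.add_sub_cancel]
    field_simp
    ring
  have hmain : 𝔼 x : V → Fin c, |monoInd (recolor e u x) f - monoInd x f| ≤
      2 * ((c : ℝ) ^ #(f ∩ e) / (c : ℝ) ^ r) := by
    calc _ ≤ 𝔼 x : V → Fin c, (monoInd (recolor e u x) f + monoInd x f) := by
          refine Finset.expect_le_expect fun x _ => ?_
          have := monoInd_nonneg x f
          have := monoInd_nonneg (recolor e u x) f
          rw [abs_le]; constructor <;> linarith
      _ = (c : ℝ) ^ #(f ∩ e) / (c : ℝ) ^ r + (c : ℝ) ^ 1 / (c : ℝ) ^ r := by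
          rw [Finset.expect_add_distrib, expect_monoInd_recolor hu hf hne,
            expect_monoInd (hne.mono Finset.inter_subset_left), hf, hp]
      _ ≤ _ := by
          rw [two_mul]
          gcongr
          exact Finset.card_pos.2 hne
  refine hmain.trans ?_
  have h1 : 1 ≤ #(f ∩ e) := Finset.card_pos.2 hne
  by_cases h2 : 2 ≤ #(f ∩ e)
  · rw [if_pos h2, if_neg (by omega), zero_add]
  · have h3 : #(f ∩ e) = 1 := by omega
    rw [if_neg h2, if_pos ⟨h3, hsub⟩, h3, hp, add_zero]

/-- The total effect of the recolourings of the hyperedges on the other hyperedges. -/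
lemma sum_expect_abs_le (hr : 1 ≤ r) {E : Finset (Finset V)} (hE : ∀ e ∈ E, #e = r)
    {u : Finset V → V} (hu : ∀ e ∈ E, u e ∈ e) :
    ∑ e ∈ E, ((c : ℝ) ^ (r - 1))⁻¹ * ∑ f ∈ E.erase e,
      𝔼 x : V → Fin c, |monoInd (recolor e (u e) x) f - monoInd x f| ≤
    2 * ((∑ e ∈ E, #{f ∈ E | #(f ∩ e) = 1 ∧ ¬ f ∩ e ⊆ {u e}} : ℕ) : ℝ) *
        ((c : ℝ) ^ (r - 1))⁻¹ ^ 2 +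
      2 * (overlap c E / (c : ℝ) ^ (2 * r - 1)) := by
  have hc0 : (c : ℝ) ≠ 0 := by exact_mod_cast NeZero.ne c
  set p : ℝ := ((c : ℝ) ^ (r - 1))⁻¹ with hp
  have hp0 : 0 ≤ p := by positivity
  push_cast
  rw [overlap, Finset.sum_div, Finset.mul_sum, Finset.sum_mul, Finset.mul_sum,
    ← Finset.sum_add_distrib]
  refine Finset.sum_le_sum fun e he => ?_
  calc _ ≤ p * ∑ f ∈ E.erase e,
        ((if #(f ∩ e) = 1 ∧ ¬ f ∩ e ⊆ {u e} then 2 * p else 0) +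
        (if 2 ≤ #(f ∩ e) then 2 * ((c : ℝ) ^ #(f ∩ e) / (c : ℝ) ^ r) else 0)) :=
        mul_le_mul_of_nonneg_left (Finset.sum_le_sum fun f hf =>
          expect_abs_monoInd_recolor_sub_le hr (hu e he) (hE f (Finset.mem_of_mem_erase hf))) hp0
    _ ≤ p * (∑ f ∈ E, (if #(f ∩ e) = 1 ∧ ¬ f ∩ e ⊆ {u e} then 2 * p else 0) +
        ∑ f ∈ E with f ≠ e ∧ 2 ≤ #(f ∩ e), 2 * ((c : ℝ) ^ #(f ∩ e) / (c : ℝ) ^ r)) := by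
        refine mul_le_mul_of_nonneg_left ?_ hp0
        rw [Finset.sum_add_distrib]
        refine add_le_add ?_ (le_of_eq ?_)
        · refine Finset.sum_le_sum_of_subset_of_nonneg (Finset.erase_subset _ _) fun f _ _ => ?_
          split_ifs <;> positivity
        · rw [← Finset.filter_filter, Finset.filter_ne', Finset.sum_filter]
    _ = _ := by
        rw [mul_add, ← Finset.sum_filter, Finset.sum_const, nsmul_eq_mul, Finset.sum_div,
          Finset.mul_sum, Finset.mul_sum]
        congr 1
        · ring
        · refine Finset.sum_congr rfl fun f _ => ?_
          rw [show 2 * r - 1 = (r - 1) + r by omega, pow_add, hp]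
          field_simp

end Estimates

/-! ### An approximate differential equation for the characteristic function. -/

section CharFun

open Finset
open scoped BigOperators

lemma norm_exp_I_mul_sub_exp_I_mul_le (a b : ℝ) :
    ‖Complex.exp (Complex.I * a) - Complex.exp (Complex.I * b)‖ ≤ |a - b| := by
  have : Complex.exp (Complex.I * a) - Complex.exp (Complex.I * b) =
      Complex.exp (Complex.I * b) * (Complex.exp (Complex.I * ((a - b : ℝ) : ℂ)) - 1) := by
    rw [mul_sub, ← Complex.exp_add, mul_one]
    congr 2
    push_cast; ring
  rw [this, norm_mul, Complex.norm_exp_I_mul_ofReal, one_mul]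
  exact Real.norm_exp_I_mul_ofReal_sub_one_le

/-- A solution of an approximate linear differential equation is close to the exact solution. -/
lemma norm_sub_exp_le_of_hasDerivAt {φ φ' ψ ψ' : ℝ → ℂ} (hφ : ∀ s, HasDerivAt φ (φ' s) s)
    (hψ : ∀ s, HasDerivAt ψ (ψ' s) s) (hφ0 : φ 0 = 1) (hψ0 : ψ 0 = 0) {M δ : ℝ}
    (hre : ∀ s, (ψ s).re ≤ 0) (hM : ∀ s, -M ≤ (ψ s).re) (hδ0 : 0 ≤ δ)
    (hδ : ∀ s, ‖φ' s - ψ' s * φ s‖ ≤ |s| * δ) (t : ℝ) :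
    ‖φ t - Complex.exp (ψ t)‖ ≤ t ^ 2 * (Real.exp M * δ) := by
  -- Integrating factor: its product with `φ` has small derivative, and multiplying back by `exp ψ`
  -- costs nothing as `re ψ ≤ 0`.
  have hg : ∀ s, HasDerivAt (fun s => φ s * Complex.exp (-ψ s))
      ((φ' s - ψ' s * φ s) * Complex.exp (-ψ s)) s := by
    intro s
    exact ((hφ s).mul ((hψ s).fun_neg.cexp)).congr_deriv (by ring)
  have hbound : ∀ s ∈ Set.Icc (-|t|) |t|,
      ‖(φ' s - ψ' s * φ s) * Complex.exp (-ψ s)‖ ≤ |t| * (Real.exp M * δ) := by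
    intro s hs
    have hs' : |s| ≤ |t| := abs_le.2 hs
    rw [norm_mul, Complex.norm_exp]
    calc _ ≤ (|s| * δ) * Real.exp M := by
          refine mul_le_mul (hδ s) (Real.exp_le_exp.2 ?_) (Real.exp_pos _).le (by positivity)
          rw [Complex.neg_re]; linarith [hM s]
      _ ≤ (|t| * δ) * Real.exp M := by gcongr
      _ = _ := by ring
  have h := Convex.norm_image_sub_le_of_norm_hasDerivWithin_le
    (fun s _ => (hg s).hasDerivWithinAt) hbound (convex_Icc _ _)
    (show (0 : ℝ) ∈ Set.Icc (-|t|) |t| by simp) (show t ∈ Set.Icc (-|t|) |t| from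
      ⟨neg_abs_le t, le_abs_self t⟩)
  rw [hφ0, hψ0, neg_zero, Complex.exp_zero, mul_one, sub_zero, Real.norm_eq_abs] at h
  have hfac : φ t - Complex.exp (ψ t) =
      Complex.exp (ψ t) * (φ t * Complex.exp (-ψ t) - 1) := by
    rw [mul_sub, mul_left_comm, ← Complex.exp_add, add_neg_cancel, Complex.exp_zero]
    ring
  rw [hfac, norm_mul, Complex.norm_exp]
  calc _ ≤ 1 * (|t| * (Real.exp M * δ) * |t|) :=
        mul_le_mul (Real.exp_le_one_iff.2 (hre t)) h (norm_nonneg _) zero_le_one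
    _ = t ^ 2 * (Real.exp M * δ) := by rw [← sq_abs t]; ring

variable {V : Type*} [DecidableEq V] [Fintype V] {c r : ℕ} [NeZero c]

lemma expect_abs_weighted_recolor_sub_le (hr : 1 ≤ r) {E : Finset (Finset V)}
    (hE : ∀ e ∈ E, #e = r) {w : Finset V → ℕ} {K : ℕ} (hw : ∀ e ∈ E, w e ≤ K)
    {e : Finset V} (he : e ∈ E) (u : V) :
    𝔼 x : V → Fin c, |∑ f ∈ E.erase e, (w f : ℝ) * monoInd (recolor e u x) f -
        ∑ f ∈ E, (w f : ℝ) * monoInd x f| ≤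
      K * (((c : ℝ) ^ (r - 1))⁻¹ + ∑ f ∈ E.erase e,
        𝔼 x : V → Fin c, |monoInd (recolor e u x) f - monoInd x f|) := by
  calc _ ≤ 𝔼 x : V → Fin c, (K * monoInd x e +
        ∑ f ∈ E.erase e, K * |monoInd (recolor e u x) f - monoInd x f|) := by
        refine Finset.expect_le_expect fun x _ => ?_
        rw [← Finset.add_sum_erase E (fun f => (w f : ℝ) * monoInd x f) he,
          sub_add_eq_sub_sub_swap, ← Finset.sum_sub_distrib, add_comm (_ * _)]
        refine (abs_sub _ _).trans (add_le_add ?_ ?_)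
        · refine (Finset.abs_sum_le_sum_abs _ _).trans (Finset.sum_le_sum fun f hf => ?_)
          rw [← mul_sub, abs_mul, Nat.abs_cast]
          have := hw f (Finset.mem_of_mem_erase hf)
          gcongr
        · have := hw e he
          have := monoInd_nonneg x e
          rw [abs_of_nonneg (by positivity)]
          gcongr
    _ = _ := by
        rw [Finset.expect_add_distrib, ← Finset.mul_expect,
          expect_monoInd (Finset.card_pos.1 (by rw [hE e he]; omega)), hE e he,
          Finset.expect_sum_comm, mul_add, Finset.mul_sum]
        simp_rw [Finset.mul_expect]

omit [NeZero c] in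
lemma hasDerivAt_expect_exp (W : (V → Fin c) → ℝ) (s : ℝ) :
    HasDerivAt (fun s : ℝ => 𝔼 x, Complex.exp (Complex.I * ((s * W x : ℝ) : ℂ)))
      (𝔼 x, Complex.I * W x * Complex.exp (Complex.I * ((s * W x : ℝ) : ℂ))) s := by
  simp only [Finset.expect_eq_sum_div_card]
  refine (HasDerivAt.fun_sum fun x _ => ?_).div_const _
  have h : HasDerivAt (fun s : ℝ => Complex.I * ((s * W x : ℝ) : ℂ)) (Complex.I * W x) s := by
    have h0 : HasDerivAt (fun s : ℝ => ((s * W x : ℝ) : ℂ)) ((1 * W x : ℝ) : ℂ) s :=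
      ((hasDerivAt_id s).mul_const (W x)).ofReal_comp
    simpa using h0.const_mul Complex.I
  exact h.cexp.congr_deriv (mul_comm _ _)

/-- This is `φ' ≈ ψ' φ`; the factor `|s|` comes from the Lipschitz bound for `exp (I * s * ·)`. -/
lemma norm_expect_exp_deriv_sub_le (hr : 1 ≤ r) {E : Finset (Finset V)}
    (hE : ∀ e ∈ E, #e = r) {w : Finset V → ℕ} {K : ℕ} (hw : ∀ e ∈ E, w e ≤ K)
    {u : Finset V → V} (hu : ∀ e ∈ E, u e ∈ e) (s : ℝ) :
    ‖(𝔼 x : V → Fin c, Complex.I * ((∑ e ∈ E, (w e : ℝ) * monoInd x e : ℝ) : ℂ) *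
        Complex.exp (Complex.I * ((s * ∑ e ∈ E, (w e : ℝ) * monoInd x e : ℝ) : ℂ))) -
      (∑ e ∈ E, ((((c : ℝ) ^ (r - 1))⁻¹ : ℝ) : ℂ) * (Complex.I * (w e : ℂ) *
        Complex.exp (Complex.I * ((s * w e : ℝ) : ℂ)))) *
      𝔼 x : V → Fin c,
        Complex.exp (Complex.I * ((s * ∑ e ∈ E, (w e : ℝ) * monoInd x e : ℝ) : ℂ))‖ ≤
    |s| * (K ^ 2 * (#E * ((c : ℝ) ^ (r - 1))⁻¹ ^ 2 +
      ∑ e ∈ E, ((c : ℝ) ^ (r - 1))⁻¹ * ∑ f ∈ E.erase e,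
        𝔼 x : V → Fin c, |monoInd (recolor e (u e) x) f - monoInd x f|)) := by
  set p : ℝ := ((c : ℝ) ^ (r - 1))⁻¹ with hp
  have hp0 : 0 ≤ p := by positivity
  set W : (V → Fin c) → ℝ := fun x => ∑ e ∈ E, (w e : ℝ) * monoInd x e with hW
  set W' : Finset V → (V → Fin c) → ℝ :=
    fun e x => ∑ f ∈ E.erase e, (w f : ℝ) * monoInd x f with hW'
  -- When `e` is monochromatic, `W = w e + W' e`; the conditioning is then replaced by recolouring.
  have h1 : (𝔼 x : V → Fin c, Complex.I * (W x : ℂ) *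
        Complex.exp (Complex.I * ((s * W x : ℝ) : ℂ))) =
      ∑ e ∈ E, (p : ℂ) * (Complex.I * (w e : ℂ) * Complex.exp (Complex.I * ((s * w e : ℝ) : ℂ))) *
        𝔼 x : V → Fin c, Complex.exp (Complex.I * ((s * W' e (recolor e (u e) x) : ℝ) : ℂ)) := by
    calc _ = 𝔼 x : V → Fin c, ∑ e ∈ E, Complex.I * (w e : ℂ) *
          Complex.exp (Complex.I * ((s * w e : ℝ) : ℂ)) *
          (if IsMono x e then Complex.exp (Complex.I * ((s * W' e x : ℝ) : ℂ)) else 0) := by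
          refine Finset.expect_congr rfl fun x _ => ?_
          have hWx : ((W x : ℝ) : ℂ) = ∑ e ∈ E, (((w e : ℝ) * monoInd x e : ℝ) : ℂ) := by
            rw [hW, Complex.ofReal_sum]
          rw [hWx, Finset.mul_sum, Finset.sum_mul]
          refine Finset.sum_congr rfl fun e he => ?_
          have hWe : W x = w e * monoInd x e + W' e x := (Finset.add_sum_erase E _ he).symm
          rw [hWe]
          by_cases hm : IsMono x e
          · have hm' : monoInd x e = 1 := if_pos hm
            rw [if_pos hm, hm', mul_assoc (_ * _) (Complex.exp _),
              ← Complex.exp_add]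
            congr 2
            · push_cast; ring
            · push_cast; ring
          · have hm' : monoInd x e = 0 := if_neg hm
            rw [if_neg hm, hm']; simp
      _ = _ := by
          rw [Finset.expect_sum_comm]
          refine Finset.sum_congr rfl fun e he => ?_
          rw [← Finset.mul_expect, expect_ite_isMono (hu e he), hE e he, hp]
          push_cast
          ring
  rw [h1, Finset.sum_mul, ← Finset.sum_sub_distrib]
  refine (norm_sum_le _ _).trans ?_
  rw [← nsmul_eq_mul, ← Finset.sum_const, ← Finset.sum_add_distrib, Finset.mul_sum,
    Finset.mul_sum]
  refine Finset.sum_le_sum fun e he => ?_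
  rw [← mul_sub, ← Finset.expect_sub_distrib, norm_mul, norm_mul, norm_mul, norm_mul,
    Complex.norm_exp_I_mul_ofReal, Complex.norm_I, Complex.norm_natCast, Complex.norm_real,
    Real.norm_of_nonneg hp0]
  have h2 : ‖𝔼 x : V → Fin c, (Complex.exp (Complex.I * ((s * W' e (recolor e (u e) x) : ℝ) : ℂ)) -
      Complex.exp (Complex.I * ((s * W x : ℝ) : ℂ)))‖ ≤
      |s| * (K * (p + ∑ f ∈ E.erase e,
        𝔼 x : V → Fin c, |monoInd (recolor e (u e) x) f - monoInd x f|)) := by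
    refine (RCLike.norm_expect_le (K := ℂ)).trans ?_
    refine le_trans (Finset.expect_le_expect fun x _ => norm_exp_I_mul_sub_exp_I_mul_le _ _) ?_
    simp_rw [← mul_sub, abs_mul]
    rw [← Finset.mul_expect]
    exact mul_le_mul_of_nonneg_left (expect_abs_weighted_recolor_sub_le hr hE hw he (u e))
      (abs_nonneg s)
  have hwe : (w e : ℝ) ≤ K := by exact_mod_cast hw e he
  calc _ ≤ p * (1 * (K : ℝ) * 1) * (|s| * (K * (p + ∑ f ∈ E.erase e,
        𝔼 x : V → Fin c, |monoInd (recolor e (u e) x) f - monoInd x f|))) := by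
        gcongr
    _ = _ := by ring

/-- The characteristic function of the weighted number of monochromatic hyperedges is close to
that of a compound Poisson law. -/
lemma norm_expect_exp_sub_le (hr : 1 ≤ r) {E : Finset (Finset V)}
    (hE : ∀ e ∈ E, #e = r) {w : Finset V → ℕ} {K : ℕ} (hw : ∀ e ∈ E, w e ≤ K)
    {u : Finset V → V} (hu : ∀ e ∈ E, u e ∈ e) (t : ℝ) :
    ‖(𝔼 x : V → Fin c,
        Complex.exp (Complex.I * ((t * ∑ e ∈ E, (w e : ℝ) * monoInd x e : ℝ) : ℂ))) -
      Complex.exp (∑ e ∈ E, ((((c : ℝ) ^ (r - 1))⁻¹ : ℝ) : ℂ) *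
        (Complex.exp (Complex.I * ((t * w e : ℝ) : ℂ)) - 1))‖ ≤
    t ^ 2 * (Real.exp (2 * (#E * ((c : ℝ) ^ (r - 1))⁻¹)) *
      (K ^ 2 * (#E * ((c : ℝ) ^ (r - 1))⁻¹ ^ 2 +
        (2 * ((∑ e ∈ E, #{f ∈ E | #(f ∩ e) = 1 ∧ ¬ f ∩ e ⊆ {u e}} : ℕ) : ℝ) *
          ((c : ℝ) ^ (r - 1))⁻¹ ^ 2 + 2 * (overlap c E / (c : ℝ) ^ (2 * r - 1)))))) := by
  set p : ℝ := ((c : ℝ) ^ (r - 1))⁻¹ with hp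
  have hp0 : 0 ≤ p := by positivity
  have hre : ∀ s : ℝ, ∀ e : Finset V,
      (((p : ℂ) * (Complex.exp (Complex.I * ((s * w e : ℝ) : ℂ)) - 1))).re =
        p * (Real.cos (s * w e) - 1) := by
    intro s e
    rw [Complex.re_ofReal_mul, Complex.sub_re, Complex.one_re, mul_comm Complex.I,
      Complex.exp_ofReal_mul_I_re]
  refine norm_sub_exp_le_of_hasDerivAt
    (φ := fun s : ℝ => 𝔼 x : V → Fin c,
        Complex.exp (Complex.I * ((s * ∑ e ∈ E, (w e : ℝ) * monoInd x e : ℝ) : ℂ)))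
    (ψ := fun s : ℝ => ∑ e ∈ E, (p : ℂ) * (Complex.exp (Complex.I * ((s * w e : ℝ) : ℂ)) - 1))
    (ψ' := fun s : ℝ => ∑ e ∈ E, (p : ℂ) * (Complex.I * (w e : ℂ) *
        Complex.exp (Complex.I * ((s * w e : ℝ) : ℂ))))
    (fun s => hasDerivAt_expect_exp _ s) (fun s => ?_) ?_ ?_ (fun s => ?_) (fun s => ?_) ?_
    (fun s => ?_) t
  · refine HasDerivAt.fun_sum fun e _ => ?_
    refine HasDerivAt.const_mul _ (HasDerivAt.sub_const _ ?_)
    have h0 : HasDerivAt (fun s : ℝ => ((s * w e : ℝ) : ℂ)) ((1 * w e : ℝ) : ℂ) s :=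
      ((hasDerivAt_id s).mul_const (w e : ℝ)).ofReal_comp
    exact (h0.const_mul Complex.I).cexp.congr_deriv (by push_cast; ring)
  · simp
  · simp
  · rw [Complex.re_sum]
    refine Finset.sum_nonpos fun e _ => ?_
    rw [hre]
    exact mul_nonpos_of_nonneg_of_nonpos hp0 (by linarith [Real.cos_le_one (s * w e)])
  · rw [Complex.re_sum, ← mul_assoc, mul_comm (2 : ℝ), mul_assoc, ← nsmul_eq_mul,
      ← Finset.sum_const, ← Finset.sum_neg_distrib]
    refine Finset.sum_le_sum fun e _ => ?_
    rw [hre]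
    nlinarith [Real.neg_one_le_cos (s * w e)]
  · have h1 := div_nonneg (overlap_nonneg c E) (pow_nonneg (Nat.cast_nonneg (α := ℝ) c) (2 * r - 1))
    exact mul_nonneg (sq_nonneg _) (add_nonneg (mul_nonneg (Nat.cast_nonneg _) (sq_nonneg _))
      (add_nonneg (mul_nonneg (mul_nonneg zero_le_two (Nat.cast_nonneg _)) (sq_nonneg _))
        (mul_nonneg zero_le_two h1)))
  · exact (norm_expect_exp_deriv_sub_le hr hE hw hu s).trans (mul_le_mul_of_nonneg_left
      (mul_le_mul_of_nonneg_left (add_le_add le_rfl (sum_expect_abs_le (c := c) hr hE hu))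
        (sq_nonneg _)) (abs_nonneg s))

end CharFun

/-! ### The error bound in terms of the mean `a`, the probability `p` and the normalised overlap
`q`. -/

section Bound

open Finset
open scoped BigOperators

variable {V : Type*} [DecidableEq V] [Fintype V] {c r : ℕ} [NeZero c]

lemma norm_expect_exp_sub_exp_le (hr : 2 ≤ r) {E : Finset (Finset V)}
    (hE : ∀ e ∈ E, #e = r) {w : Finset V → ℕ} {K : ℕ} (hw : ∀ e ∈ E, w e ≤ K)
    (t : ℝ) {a p q : ℝ} (hp : p = ((c : ℝ) ^ (r - 1))⁻¹) (ha : a = #E * p)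
    (hq : q = overlap c E / (c : ℝ) ^ (2 * r - 1)) :
    ‖(𝔼 x : V → Fin c,
        Complex.exp (Complex.I * ((t * ∑ e ∈ E, (w e : ℝ) * monoInd x e : ℝ) : ℂ))) -
      Complex.exp (∑ e ∈ E, (p : ℂ) *
        (Complex.exp (Complex.I * ((t * w e : ℝ) : ℂ)) - 1))‖ ≤
    t ^ 2 * (Real.exp (2 * a) * (K ^ 2 * (a * p +
      (2 * √(r ^ 2 * (a * p + q) * (r * a) ^ 2) + 2 * q)))) := by
  have hc1 : (1 : ℝ) ≤ c := by exact_mod_cast NeZero.one_le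
  have hc0 : (0 : ℝ) < c := by linarith
  have hp0 : 0 ≤ p := by rw [hp]; positivity
  have ha0 : 0 ≤ a := by rw [ha]; positivity
  have hq0 : 0 ≤ q := by rw [hq]; exact div_nonneg (overlap_nonneg c E) (by positivity)
  -- A hyperedge supplies the vertex that `exists_vertex_choice` needs.
  rcases E.eq_empty_or_nonempty with rfl | ⟨e₀, he₀⟩
  · simp only [Finset.sum_empty, mul_zero, Complex.ofReal_zero, Complex.exp_zero,
      Fintype.expect_const, sub_self, norm_zero]
    positivity
  obtain ⟨v₀, -⟩ : e₀.Nonempty := Finset.card_pos.1 (by rw [hE e₀ he₀]; omega)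
  have : Nonempty V := ⟨v₀⟩
  obtain ⟨u, hu, hR⟩ := exists_vertex_choice (r := r) (by omega) hE
  have hR' := hR.trans (mul_le_mul_of_nonneg_right
    (sum_sum_ite_sq_le (r := r) (c := c) NeZero.one_le E) (sq_nonneg _))
  have hmain := norm_expect_exp_sub_le (c := c) (by omega) hE hw hu t
  rw [← hp, ← ha, ← hq] at hmain
  set R : ℝ := ((∑ e ∈ E, #{f ∈ E | #(f ∩ e) = 1 ∧ ¬ f ∩ e ⊆ {u e}} : ℕ) : ℝ) with hRdef
  have hq' : overlap c E / (c : ℝ) ^ 2 * p ^ 2 ≤ q := by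
    rw [hq, hp, inv_pow, ← pow_mul, ← div_eq_mul_inv, div_div, ← pow_add]
    refine div_le_div_of_nonneg_left (overlap_nonneg c E) (by positivity) ?_
    exact pow_le_pow_right₀ hc1 (by omega)
  have hRp : R * p ^ 2 ≤ √(r ^ 2 * (a * p + q) * (r * a) ^ 2) := by
    refine Real.le_sqrt_of_sq_le ?_
    calc (R * p ^ 2) ^ 2 = R ^ 2 * p ^ 4 := by ring
      _ ≤ ((r : ℝ) ^ 2 * (#E + overlap c E / (c : ℝ) ^ 2) * (r * #E) ^ 2) * p ^ 4 := by gcongr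
      _ = (r : ℝ) ^ 2 * (a * p + overlap c E / (c : ℝ) ^ 2 * p ^ 2) * (r * a) ^ 2 := by
          rw [ha]; ring
      _ ≤ _ := by gcongr
  refine hmain.trans ?_
  have h1 : (#E : ℝ) * p ^ 2 = a * p := by rw [ha]; ring
  rw [h1, mul_assoc 2 R]
  gcongr

end Bound

/-! ### From hypergraphs and random variables to finite sums and averages. -/

section Transfer

open Finset
open scoped BigOperators

namespace Hypergraph

variable {α : Type*} {H : Hypergraph α}

/-- A finite set of elements of the vertex set of `H`, as a set of the ambient type. -/
def toSet (e : Finset H.vertexSet) : Set α := Subtype.val '' (e : Set H.vertexSet)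

lemma toSet_injective : Function.Injective (toSet (H := H)) :=
  (Set.image_injective.2 Subtype.val_injective).comp Finset.coe_injective

lemma isMonochromatic_toSet {c : ℕ} (x : H.vertexSet → Fin c) (e : Finset H.vertexSet) :
    IsMonochromatic x (toSet e) ↔ IsMono x e := by
  simp only [toSet, IsMonochromatic, Subtype.val_injective.mem_set_image, Finset.mem_coe]
  exact ⟨fun h u hu v hv => h u v hu hv, fun h u v hu hv => h u hu v hv⟩

open Classical in
/-- The hyperedges of `H` as finite sets of elements of the vertex set of `H`. -/
noncomputable def edgeFinsets (H : Hypergraph α) [Fintype H.vertexSet] :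
    Finset (Finset H.vertexSet) :=
  {e | toSet e ∈ H.edgeSet}

variable [Fintype H.vertexSet]

lemma mem_edgeFinsets {e : Finset H.vertexSet} : e ∈ H.edgeFinsets ↔ toSet e ∈ H.edgeSet := by
  simp [edgeFinsets]

lemma exists_toSet_eq {s : Set α} (hs : s ⊆ H.vertexSet) :
    ∃ e : Finset H.vertexSet, toSet e = s := by
  classical
  refine ⟨(Set.toFinite (Subtype.val ⁻¹' s : Set H.vertexSet)).toFinset, ?_⟩
  rw [toSet, Set.Finite.coe_toFinset, Subtype.image_preimage_coe, Set.inter_eq_right.2 hs]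

lemma image_edgeFinsets :
    toSet '' (H.edgeFinsets : Set (Finset H.vertexSet)) = H.edgeSet := by
  ext s
  constructor
  · rintro ⟨e, he, rfl⟩
    exact mem_edgeFinsets.1 he
  · intro hs
    obtain ⟨e, rfl⟩ := exists_toSet_eq (H.subset_vertexSet_of_mem_edgeSet' hs)
    exact ⟨e, mem_edgeFinsets.2 hs, rfl⟩

lemma finsum_mem_edgeSet {M : Type*} [AddCommMonoid M] (f : Set α → M) :
    ∑ᶠ e ∈ H.edgeSet, f e = ∑ e ∈ H.edgeFinsets, f (toSet e) := by
  rw [← image_edgeFinsets, finsum_mem_image toSet_injective.injOn, finsum_mem_coe_finset]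

lemma card_of_mem_edgeFinsets {r : ℕ} (hH : H.IsUniformOfSize r) {e : Finset H.vertexSet}
    (he : e ∈ H.edgeFinsets) : #e = r := by
  rw [← hH _ (mem_edgeFinsets.1 he), toSet, Set.ncard_image_of_injective _ Subtype.val_injective,
    Set.ncard_coe_finset]

lemma weightedMonoCount_eq_sum {c : ℕ} (w : Set α → ℕ) (x : H.vertexSet → Fin c) :
    (H.weightedMonoCount w x : ℝ) =
      ∑ e ∈ H.edgeFinsets, (w (toSet e) : ℝ) * monoInd x e := by
  rw [weightedMonoCount, finsum_mem_edgeSet]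
  push_cast
  refine Finset.sum_congr rfl fun e _ => ?_
  simp only [isMonochromatic_toSet, monoInd]

lemma monoCount_weightLayer_eq_sum {c : ℕ} (w : Set α → ℕ) (i : ℕ) (x : H.vertexSet → Fin c) :
    ((H.weightLayer w i).monoCount x : ℝ) =
      ∑ e ∈ H.edgeFinsets.filter (fun e => w (toSet e) = i), monoInd x e := by
  have h : ∀ f : Set α → ℕ, ∑ᶠ e ∈ (H.weightLayer w i).edgeSet, f e =
      ∑ e ∈ H.edgeFinsets.filter (fun e => w (toSet e) = i), f (toSet e) := by
    intro f
    rw [finsum_mem_edgeSet (H := H.weightLayer w i)]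
    refine Finset.sum_congr ?_ fun _ _ => rfl
    ext e
    rw [mem_edgeFinsets, Finset.mem_filter, mem_edgeFinsets]
    rfl
  rw [monoCount, h]
  push_cast
  refine Finset.sum_congr rfl fun e _ => ?_
  have he : IsMonochromatic (V := H.vertexSet) x (toSet e) ↔ IsMono x e :=
    isMonochromatic_toSet x e
  simp only [he, monoInd]

end Hypergraph

variable {V Ω : Type*} [Fintype V] [MeasurableSpace Ω] {c : ℕ} {X : V → Ω → Fin c}
  {P : Measure Ω} [IsProbabilityMeasure P]

omit [Fintype V] [IsProbabilityMeasure P] in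
lemma IsUniformColoring.measurable_pi (hX : IsUniformColoring X P) :
    Measurable fun ω v => X v ω := measurable_pi_lambda _ hX.measurable

omit [IsProbabilityMeasure P] in
lemma IsUniformColoring.measurable_comp {F : Type*} [MeasurableSpace F]
    (hX : IsUniformColoring X P) (g : (V → Fin c) → F) :
    Measurable fun ω => g fun v => X v ω :=
  (measurable_of_countable g).comp hX.measurable_pi

/-- By independence each colouring has mass `c ^ (-#V)`, so the earlier estimates for averages apply
to integrals. -/
lemma IsUniformColoring.integral_comp [DecidableEq V] {𝕜 : Type*} [RCLike 𝕜]
    (hX : IsUniformColoring X P) (g : (V → Fin c) → 𝕜) :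
    ∫ ω, g (fun v => X v ω) ∂P = 𝔼 x, g x := by
  have : IsProbabilityMeasure (P.map fun ω v => X v ω) :=
    Measure.isProbabilityMeasure_map hX.measurable_pi.aemeasurable
  rw [← integral_map (f := g) hX.measurable_pi.aemeasurable
    (measurable_of_countable g).aestronglyMeasurable, integral_fintype Integrable.of_finite,
    Finset.expect_eq_sum_div_card, Finset.sum_div]
  refine Finset.sum_congr rfl fun x _ => ?_
  have h : (P.map fun ω v => X v ω).real {x} = ((c : ℝ) ^ Fintype.card V)⁻¹ := by
    rw [measureReal_def, Measure.map_apply hX.measurable_pi (measurableSet_singleton x)]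
    have hset : (fun ω v => X v ω) ⁻¹' {x} = ⋂ v, {ω | X v ω = x v} := by
      ext ω
      simp [funext_iff]
    rw [hset, hX.indep.meas_iInter (s := fun v => {ω | X v ω = x v})
      fun v => ⟨{x v}, measurableSet_singleton _, rfl⟩,
      ENNReal.toReal_prod]
    calc _ = ∏ _v : V, 1 / (c : ℝ) := Finset.prod_congr rfl fun v _ => hX.prob_eq v (x v)
      _ = _ := by simp
  rw [h, Finset.card_univ, Fintype.card_fun, Fintype.card_fin, RCLike.real_smul_eq_coe_mul]
  push_cast
  rw [div_eq_mul_inv, mul_comm]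

lemma IsUniformColoring.variance_comp [DecidableEq V]
    (hX : IsUniformColoring X P) (g : (V → Fin c) → ℝ) :
    variance (fun ω => g fun v => X v ω) P = (𝔼 x, g x ^ 2) - (𝔼 x, g x) ^ 2 := by
  have : IsProbabilityMeasure (P.map fun ω v => X v ω) :=
    Measure.isProbabilityMeasure_map hX.measurable_pi.aemeasurable
  have hmem : MemLp (fun ω => g fun v => X v ω) 2 P :=
    (MemLp.of_discrete (μ := P.map fun ω v => X v ω) (f := g)).comp_of_map
      hX.measurable_pi.aemeasurable
  rw [variance_eq_sub hmem, hX.integral_comp g, ← hX.integral_comp fun x => g x ^ 2]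
  rfl

lemma IsUniformColoring.charFun_map [DecidableEq V]
    (hX : IsUniformColoring X P) (g : (V → Fin c) → ℝ) (t : ℝ) :
    charFun (P.map fun ω => g fun v => X v ω) t =
      𝔼 x, Complex.exp (Complex.I * ((t * g x : ℝ) : ℂ)) := by
  rw [charFun_apply_real, integral_map (hX.measurable_comp g).aemeasurable (by fun_prop),
    ← hX.integral_comp]
  refine integral_congr_ae (.of_forall fun ω => ?_)
  push_cast
  rw [mul_comm]

omit [Fintype V] [IsProbabilityMeasure P] in
/-- The characteristic function of a linear combination of independent Poisson variables. -/
lemma charFun_map_sum_mul_poisson {s : Finset ℕ} {lam : s → ℝ≥0} {Z : s → Ω → ℕ}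
    (hZ : ∀ i, HasLaw (Z i) (poissonMeasure (lam i)) P) (hZindep : iIndepFun Z P) (t : ℝ) :
    charFun (P.map fun ω => ∑ i : s, ((i : ℕ) : ℝ) * (Z i ω : ℝ)) t =
      Complex.exp (∑ i : s, ((lam i : ℝ) : ℂ) *
        (Complex.exp (Complex.I * ((t * (i : ℕ) : ℝ) : ℂ)) - 1)) := by
  have hmeas : ∀ i, AEMeasurable (fun ω => (Z i ω : ℝ)) P := fun i =>
    (measurable_of_countable (fun k : ℕ => (k : ℝ))).comp_aemeasurable (hZ i).aemeasurable
  have hind : iIndepFun (fun (i : s) ω => ((i : ℕ) : ℝ) * (Z i ω : ℝ)) P :=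
    hZindep.comp (fun i k => ((i : ℕ) : ℝ) * (k : ℝ)) fun i => measurable_of_countable _
  rw [hind.charFun_map_fun_sum_eq_prod fun i => (hmeas i).const_mul _, Finset.prod_apply,
    Complex.exp_sum]
  refine Finset.prod_congr rfl fun i _ => ?_
  have hmap : P.map (fun ω => (Z i ω : ℝ)) = (poissonMeasure (lam i)).map (fun k : ℕ => (k : ℝ)) := by
    rw [← (hZ i).map_eq, AEMeasurable.map_map_of_aemeasurable
      (measurable_of_countable _).aemeasurable (hZ i).aemeasurable]
    rfl
  rw [charFun_map_mul_comp (hmeas i), hmap]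
  refine (charFun_map_cast_poissonMeasure (lam i) _).trans ?_
  congr 4
  push_cast
  ring

end Transfer

/-! ### Passage to the limit. -/

section Limit

open Finset
open scoped BigOperators

variable {V : ℕ → Type*} [∀ n, DecidableEq (V n)] [∀ n, Fintype (V n)] {r : ℕ} {c : ℕ → ℕ}
  {E : ∀ n, Finset (Finset (V n))} {w : ∀ n, Finset (V n) → ℕ} {s : Finset ℕ} {lam : s → ℝ}

lemma tendsto_inv_pow_atTop (hr : 2 ≤ r) (hc : Tendsto c atTop atTop) :
    Tendsto (fun n => ((c n : ℝ) ^ (r - 1))⁻¹) atTop (𝓝 0) :=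
  tendsto_inv_atTop_zero.comp ((tendsto_pow_atTop (by omega)).comp
    (tendsto_natCast_atTop_atTop.comp hc))

omit [∀ n, DecidableEq (V n)] [∀ n, Fintype (V n)] in
lemma tendsto_card_mul (hw : ∀ n, ∀ e ∈ E n, w n e ∈ s)
    (hmean : ∀ i : s, Tendsto (fun n => (#{e ∈ E n | w n e = i} : ℝ) *
      ((c n : ℝ) ^ (r - 1))⁻¹) atTop (𝓝 (lam i))) :
    Tendsto (fun n => (#(E n) : ℝ) * ((c n : ℝ) ^ (r - 1))⁻¹) atTop (𝓝 (∑ i, lam i)) := by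
  refine (tendsto_finsetSum Finset.univ fun i _ => hmean i).congr fun n => ?_
  rw [← Finset.sum_mul, Finset.sum_coe_sort s fun i => (#{e ∈ E n | w n e = i} : ℝ),
    Finset.card_eq_sum_card_fiberwise (f := w n) (t := s) fun e he => hw n e he]
  push_cast
  rfl

lemma tendsto_overlap_div_layer (hr : 2 ≤ r) (hE : ∀ n, ∀ e ∈ E n, #e = r)
    (hc : Tendsto c atTop atTop) {l : ℝ}
    (hmean : Tendsto (fun n => (#(E n) : ℝ) * ((c n : ℝ) ^ (r - 1))⁻¹) atTop (𝓝 l))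
    (hvar : Tendsto (fun n => (𝔼 x : V n → Fin (c n), (∑ e ∈ E n, monoInd x e) ^ 2) -
      (#(E n) * ((c n : ℝ) ^ (r - 1))⁻¹) ^ 2) atTop (𝓝 l)) :
    Tendsto (fun n => overlap (c n) (E n) / (c n : ℝ) ^ (2 * r - 1)) atTop (𝓝 0) := by
  have hlim := ((hvar.sub hmean).add (hmean.mul (tendsto_inv_pow_atTop hr hc))).const_mul 2
  rw [sub_self, mul_zero, add_zero, mul_zero] at hlim
  refine squeeze_zero' (.of_forall fun n => div_nonneg (overlap_nonneg _ _) (by positivity)) ?_ hlim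
  -- `overlap_div_le` needs at least two colours.
  filter_upwards [hc.eventually_ge_atTop 2] with n hn
  have : NeZero (c n) := ⟨by omega⟩
  refine (overlap_div_le hn hr (hE n)).trans (le_of_eq ?_)
  ring

lemma tendsto_overlap_div (hr : 2 ≤ r) (hE : ∀ n, ∀ e ∈ E n, #e = r)
    (hw : ∀ n, ∀ e ∈ E n, w n e ∈ s) (hc : Tendsto c atTop atTop)
    (hmean : ∀ i : s, Tendsto (fun n => (#{e ∈ E n | w n e = i} : ℝ) *
      ((c n : ℝ) ^ (r - 1))⁻¹) atTop (𝓝 (lam i)))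
    (hover : ∀ i : s, Tendsto (fun n => overlap (c n) {e ∈ E n | w n e = i} /
      (c n : ℝ) ^ (2 * r - 1)) atTop (𝓝 0)) :
    Tendsto (fun n => overlap (c n) (E n) / (c n : ℝ) ^ (2 * r - 1)) atTop (𝓝 0) := by
  have hcinv : Tendsto (fun n => ((c n : ℝ))⁻¹) atTop (𝓝 0) :=
    tendsto_inv_atTop_zero.comp (tendsto_natCast_atTop_atTop.comp hc)
  -- The diagonal term of a layer, divided by `c ^ (2 * r - 1)`, is the layer's mean times `c⁻¹`.
  have hlim := (tendsto_finsetSum Finset.univ fun i (_ : i ∈ (Finset.univ : Finset s)) =>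
    (((hmean i).mul hcinv).add (hover i)).const_mul ((2 : ℝ) ^ r)).const_mul (#s : ℝ)
  simp only [mul_zero, add_zero, Finset.sum_const_zero] at hlim
  refine squeeze_zero' (.of_forall fun n => div_nonneg (overlap_nonneg _ _) (by positivity)) ?_ hlim
  filter_upwards [hc.eventually_ge_atTop 1] with n hn
  have hc0 : (c n : ℝ) ≠ 0 := by
    have : c n ≠ 0 := by omega
    exact_mod_cast this
  rw [Finset.sum_coe_sort s fun i => (2 : ℝ) ^ r * ((#{e ∈ E n | w n e = i} : ℝ) *
    ((c n : ℝ) ^ (r - 1))⁻¹ * (c n : ℝ)⁻¹ +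
      overlap (c n) {e ∈ E n | w n e = i} / (c n : ℝ) ^ (2 * r - 1))]
  refine (div_le_div_of_nonneg_right (overlap_le_sum_layers hn (hE n) (hw n))
    (by positivity)).trans (le_of_eq ?_)
  rw [mul_div_assoc, Finset.sum_div]
  congr 1
  refine Finset.sum_congr rfl fun i _ => ?_
  obtain ⟨k, rfl⟩ : ∃ k, r = k + 1 := ⟨r - 1, by omega⟩
  rw [show 2 * (k + 1) - 1 = k + k + 1 by omega, Nat.add_sub_cancel, pow_succ, pow_add]
  field_simp
  ring

/-- The characteristic function of the weighted number of monochromatic hyperedges converges to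
that of a compound Poisson law. -/
lemma tendsto_expect_exp {K : ℕ} (hr : 2 ≤ r) (hE : ∀ n, ∀ e ∈ E n, #e = r)
    (hs : ∀ i ∈ s, i ≤ K) (hw : ∀ n, ∀ e ∈ E n, w n e ∈ s) (hc : Tendsto c atTop atTop)
    (hmean : ∀ i : s, Tendsto (fun n => (#{e ∈ E n | w n e = i} : ℝ) *
      ((c n : ℝ) ^ (r - 1))⁻¹) atTop (𝓝 (lam i)))
    (hvar : ∀ i : s, Tendsto (fun n =>
      (𝔼 x : V n → Fin (c n), (∑ e ∈ E n with w n e = i, monoInd x e) ^ 2) -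
        (#{e ∈ E n | w n e = i} * ((c n : ℝ) ^ (r - 1))⁻¹) ^ 2) atTop (𝓝 (lam i))) (t : ℝ) :
    Tendsto (fun n => 𝔼 x : V n → Fin (c n),
        Complex.exp (Complex.I * ((t * ∑ e ∈ E n, (w n e : ℝ) * monoInd x e : ℝ) : ℂ))) atTop
      (𝓝 (Complex.exp (∑ i : s, (lam i : ℂ) *
        (Complex.exp (Complex.I * ((t * (i : ℕ) : ℝ) : ℂ)) - 1)))) := by
  have hp := tendsto_inv_pow_atTop hr hc
  have ha := tendsto_card_mul hw hmean
  have hq := tendsto_overlap_div hr hE hw hc hmean fun i =>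
    tendsto_overlap_div_layer hr (fun n e he => hE n e (Finset.mem_filter.1 he).1) hc
      (hmean i) (hvar i)
  -- Grouping the hyperedges by weight turns the exponent into a finite combination of the layer
  -- means.
  have hψ : Tendsto (fun n => Complex.exp (∑ e ∈ E n, ((((c n : ℝ) ^ (r - 1))⁻¹ : ℝ) : ℂ) *
        (Complex.exp (Complex.I * ((t * w n e : ℝ) : ℂ)) - 1))) atTop
      (𝓝 (Complex.exp (∑ i : s, (lam i : ℂ) *
        (Complex.exp (Complex.I * ((t * (i : ℕ) : ℝ) : ℂ)) - 1)))) := by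
    refine ((Complex.continuous_exp.tendsto _).comp (tendsto_finsetSum Finset.univ fun i _ =>
      ((Complex.continuous_ofReal.tendsto _).comp (hmean i)).mul_const
        (Complex.exp (Complex.I * ((t * (i : ℕ) : ℝ) : ℂ)) - 1))).congr fun n => ?_
    simp only [Function.comp_apply]
    congr 1
    rw [Finset.sum_coe_sort s fun i => (((#{e ∈ E n | w n e = i} : ℝ) *
      ((c n : ℝ) ^ (r - 1))⁻¹ : ℝ) : ℂ) * (Complex.exp (Complex.I * ((t * i : ℝ) : ℂ)) - 1),
      ← Finset.sum_fiberwise_of_maps_to (hw n)]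
    refine Finset.sum_congr rfl fun i _ => ?_
    rw [Finset.sum_congr rfl (g := fun _ => ((((c n : ℝ) ^ (r - 1))⁻¹ : ℝ) : ℂ) *
      (Complex.exp (Complex.I * ((t * i : ℝ) : ℂ)) - 1))
      fun e he => by rw [(Finset.mem_filter.1 he).2], Finset.sum_const, nsmul_eq_mul]
    push_cast
    ring
  have hsqrt := (((((ha.mul hp).add hq).const_mul ((r : ℝ) ^ 2)).mul
    ((ha.const_mul (r : ℝ)).pow 2)).sqrt).const_mul 2
  have hbound := ((((Real.continuous_exp.tendsto _).comp (ha.const_mul 2)).mul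
    (((ha.mul hp).add (hsqrt.add (hq.const_mul 2))).const_mul ((K : ℝ) ^ 2)))).const_mul (t ^ 2)
  simp only [mul_zero, add_zero, zero_mul, Real.sqrt_zero] at hbound
  have hdiff : Tendsto (fun n => (𝔼 x : V n → Fin (c n),
        Complex.exp (Complex.I * ((t * ∑ e ∈ E n, (w n e : ℝ) * monoInd x e : ℝ) : ℂ))) -
      Complex.exp (∑ e ∈ E n, ((((c n : ℝ) ^ (r - 1))⁻¹ : ℝ) : ℂ) *
        (Complex.exp (Complex.I * ((t * w n e : ℝ) : ℂ)) - 1))) atTop (𝓝 0) := by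
    refine squeeze_zero_norm' ?_ hbound
    filter_upwards [hc.eventually_ge_atTop 1] with n hn
    have : NeZero (c n) := ⟨by omega⟩
    exact norm_expect_exp_sub_exp_le hr (hE n) (fun e he => hs _ (hw n e he)) t rfl rfl rfl
  simpa using hdiff.add hψ

end Limit

theorem corollary1p11 (r K : ℕ) (hr : 2 ≤ r) (hK : 1 ≤ K)
    -- weighted finite `r`-uniform hypergraphs with integer weights in `[1, K]`
    (α : ℕ → Type*) (H : ∀ n, Hypergraph (α n)) (w : ∀ n, Set (α n) → ℕ)
    (hfin : ∀ n, (H n).vertexSet.Finite)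
    (hunif : ∀ n, (H n).IsUniformOfSize r)
    (hw : ∀ n, ∀ e ∈ (H n).edgeSet, w n e ∈ Finset.Icc 1 K)
    -- uniformly random vertex colourings with `c n` colours
    (c : ℕ → ℕ) (hc : Tendsto c atTop atTop)
    (Ω : ℕ → Type*) [∀ n, MeasurableSpace (Ω n)]
    (P : ∀ n, Measure (Ω n)) [∀ n, IsProbabilityMeasure (P n)]
    (X : ∀ n, (H n).vertexSet → Ω n → Fin (c n))
    (hX : ∀ n, IsUniformColoring (X n) (P n))
    -- mean and variance of the monochromatic count of each layer
    (lam : Finset.Icc 1 K → ℝ≥0)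
    (hmean : ∀ i : Finset.Icc 1 K, Tendsto
      (fun n => ∫ ω, (((H n).weightLayer (w n) i).monoCount (fun v => X n v ω) : ℝ) ∂(P n))
      atTop (𝓝 (lam i : ℝ)))
    (hvar : ∀ i : Finset.Icc 1 K, Tendsto
      (fun n => variance
        (fun ω => (((H n).weightLayer (w n) i).monoCount (fun v => X n v ω) : ℝ)) (P n))
      atTop (𝓝 (lam i : ℝ)))
    -- independent Poisson random variables
    (Ω' : Type*) [MeasurableSpace Ω'] (P' : Measure Ω') [IsProbabilityMeasure P']
    (Z : Finset.Icc 1 K → Ω' → ℕ)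
    (hZ : ∀ i, HasLaw (Z i) (poissonMeasure (lam i)) P')
    (hZindep : iIndepFun Z P') :
    TendstoInDistribution
      (fun n ω => ((H n).weightedMonoCount (w n) (fun v => X n v ω) : ℝ)) atTop
      (fun ω => ∑ i : Finset.Icc 1 K, ((i : ℕ) : ℝ) * (Z i ω : ℝ)) P P' := by
  classical
  have : ∀ n, Fintype (H n).vertexSet := fun n => (hfin n).fintype
  set E := fun n => (H n).edgeFinsets with hEdef
  set w' : ∀ n, Finset (H n).vertexSet → ℕ := fun n e => w n (Hypergraph.toSet e) with hw'
  have hE : ∀ n, ∀ e ∈ E n, e.card = r := fun n e he =>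
    Hypergraph.card_of_mem_edgeFinsets (hunif n) he
  have hwE : ∀ n, ∀ e ∈ E n, w' n e ∈ Finset.Icc 1 K := fun n e he =>
    hw n _ (Hypergraph.mem_edgeFinsets.1 he)
  have hlayer : ∀ n (i : ℕ) (x : (H n).vertexSet → Fin (c n)),
      (((H n).weightLayer (w n) i).monoCount x : ℝ) =
        ∑ e ∈ E n with w' n e = i, monoInd x e := fun n i x =>
    Hypergraph.monoCount_weightLayer_eq_sum (w n) i x
  have hexp : ∀ i : Finset.Icc 1 K, ∀ᶠ n in atTop,
      Finset.expect Finset.univ (fun x : (H n).vertexSet → Fin (c n) =>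
        ∑ e ∈ E n with w' n e = i, monoInd x e) =
      (Finset.card {e ∈ E n | w' n e = i} : ℝ) * ((c n : ℝ) ^ (r - 1))⁻¹ := by
    intro i
    filter_upwards [hc.eventually_ge_atTop 1] with n hn
    have : NeZero (c n) := ⟨by omega⟩
    exact expect_sum_monoInd (by omega) fun e he => hE n e (Finset.mem_filter.1 he).1
  have hlim := fun t : ℝ => tendsto_expect_exp (lam := fun i => (lam i : ℝ)) hr hE
    (fun i hi => (Finset.mem_Icc.1 hi).2) hwE hc
    (fun i => (hmean i).congr' (by
      filter_upwards [hexp i] with n hn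
      rw [← hn, ← (hX n).integral_comp]
      simp_rw [hlayer]))
    (fun i => (hvar i).congr' (by
      filter_upwards [hexp i] with n hn
      rw [← hn, ← (hX n).variance_comp]
      simp_rw [hlayer])) t
  refine ⟨fun n => ((hX n).measurable_comp
    fun x => ((H n).weightedMonoCount (w n) x : ℝ)).aemeasurable, ?_, ?_⟩
  · exact Finset.aemeasurable_fun_sum _ fun i _ => ((measurable_of_countable
      (fun k : ℕ => (k : ℝ))).comp_aemeasurable (hZ i).aemeasurable).const_mul _
  -- Lévy's continuity theorem.
  · refine ProbabilityMeasure.tendsto_iff_tendsto_charFun.2 fun t => ?_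
    simp only [ProbabilityMeasure.coe_mk]
    rw [charFun_map_sum_mul_poisson hZ hZindep]
    refine (hlim t).congr fun n => ?_
    rw [(hX n).charFun_map fun x => ((H n).weightedMonoCount (w n) x : ℝ)]
    simp_rw [Hypergraph.weightedMonoCount_eq_sum]
    rfl
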